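/- **Theorem 1.2.** The spread of a finite simple graph is the largest minus the smallest eigenvalue of its adjacency matrix. For integers $n \ge 1$ and $0\le e \le \lfloor n^2/4\rfloor$, let $s(n,e)$ be the maximum spread over all graphs with $n$ vertices and $e$ edges, and let $s_b(n,e)$ be the maximum spread over all bipartite graphs with $n$ vertices and $e$ edges. Then $$s(n,e)-s_b(n,e)\le \frac{1+16\,e^{-3/4}}{e^{3/4}}\,s(n,e)$$ for all integers $n, e\ge 1$ with $e\le\lfloor n^2/4\rfloor$. Hence the Bipartite Spread Conjecture ($s_b(n,e)=s(n,e)$ for all $e\le\lfloor n^2/4\rfloor$) holds asymptotically: for every $\varepsilon>0$ there is $e_0$ such that $s_b(n,e)\ge(1-\varepsilon)\,s(n,e)$ for all $n$ and $e$ with $e_0\le e\le\lfloor n^2/4\rfloor$. Conversely, for every $\varepsilon>0$ there is $n_\varepsilon$ such that for every $n\ge n_\varepsilon$ there is an integer $e$ (depending on $n$) with $1\le e\le\lfloor n^2/4\rfloor$ and $$s(n,e)-s_b(n,e)\ge\frac{1-\varepsilon}{e^{3/4}}\,s(n,e).$$ In particular the exact conjecture fails for infinitely many $n$: there are infinitely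 many $n$ for which $s_b(n,e)<s(n,e)$ for some $e\le\lfloor n^2/4\rfloor$. -/

import Mathlib

/-- The spread of a finite simple graph: the diameter of the spectrum of its (real, symmetric)
adjacency matrix, that is, the largest eigenvalue minus the smallest eigenvalue. -/
noncomputable def graphSpread {V : Type*} [Fintype V] (G : SimpleGraph V) : ℝ := by
  classical
  exact Metric.diam (spectrum ℝ (G.adjMatrix ℝ))

/-- `s(n, e)`: the maximum spread over all graphs with `n` vertices and `e` edges.
There are only finitely many graphs on `Fin n`, so the supremum is a maximum as soon as such a
graph exists. -/
noncomputable def maxSpread (n e : ℕ) : ℝ :=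
  sSup {x : ℝ | ∃ G : SimpleGraph (Fin n), G.edgeSet.ncard = e ∧ graphSpread G = x}

/-- `s_b(n, e)`: the maximum spread over all bipartite graphs with `n` vertices and `e` edges
(such graphs exist exactly when `e ≤ ⌊n² / 4⌋`). -/
noncomputable def maxBipartiteSpread (n e : ℕ) : ℝ :=
  sSup {x : ℝ | ∃ G : SimpleGraph (Fin n),
    G.IsBipartite ∧ G.edgeSet.ncard = e ∧ graphSpread G = x}

/-!
# The bipartite spread conjecture, asymptotically

Write `A` for the adjacency matrix. Since `tr A ^ 2 = 2 e`, every spread is at most `2 √e`. In the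
other direction, for disjoint sets `P` and `Q` of `p` and `q` vertices the vectors
`1_P / √p ± 1_Q / √q` show that the spread is at least `2 e(P, Q) / √(p q)`
(`two_mul_sum_le_graphSpread`). Everything depends on how close the products `p q` with `p + q ≤ n`
come to `e`.

*Upper bound.* There is always such a product `p q = e + r` with `0 ≤ r ≤ 2 e ^ (1 / 4)`
(`exists_mul_close`). Deleting any `r` edges of `K_{p,q}` gives a bipartite graph of spread at least
`2 e / √(e + r) ≥ (1 - e ^ (-3 / 4)) 2 √e`. The term `16 e ^ (-3 / 4)` of the statement is not
needed.

*Tightness.* Let `e = p₀ q₀ + 1`, where `p₀ + q₀ = n`, `p₀ - q₀` is about `√(2 n)`, and the next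
larger product is about `p₀ q₀ + 2 e ^ (1 / 4)`. Adding an edge inside the larger part of
`K_{p₀,q₀}` does not lower its spread, so `s(n, e) ≥ 2 √(e - 1)`. A bipartite graph with `n`
vertices and `e` edges must miss about `2 e ^ (1 / 4)` or more of the `p q` edges between its parts.
Its spread is at most `(8 tr A ^ 4) ^ (1 / 4)`, and `tr A ^ 4` is twice the number of pairs of
edges that span a `4`-cycle pattern, possibly degenerate, between the parts. Each missing edge
destroys almost `2 e` of the `e ^ 2` possible pairs (`trace_sq_mul_transpose_le`), so that
`s_b(n, e)` is at most `(1 - (1 - o(1)) e ^ (-3 / 4)) 2 √e`.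
-/

open Finset

/-! ### Spectra of symmetric real matrices -/

namespace Matrix.IsHermitian

variable {V : Type*} [Fintype V] [DecidableEq V] {A : Matrix V V ℝ}

theorem trace_pow_eq_sum_eigenvalues (hA : A.IsHermitian) (k : ℕ) :
    (A ^ k).trace = ∑ i, hA.eigenvalues i ^ k := by
  conv_lhs => rw [hA.spectral_theorem, ← map_pow, diagonal_pow, Unitary.conjStarAlgAut_apply,
    trace_mul_cycle, Unitary.coe_star_mul_self, one_mul, trace_diagonal]
  simp

theorem dotProduct_mulVec_le (hA : A.IsHermitian) {c : ℝ} (hc : ∀ i, hA.eigenvalues i ≤ c)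
    (x : V → ℝ) : x ⬝ᵥ A *ᵥ x ≤ c * (x ⬝ᵥ x) := by
  have hB : (algebraMap ℝ (Matrix V V ℝ) c - A).IsHermitian := by
    refine IsHermitian.sub ?_ hA
    simp [Matrix.IsHermitian, Matrix.algebraMap_eq_diagonal]
  have hpsd : (algebraMap ℝ (Matrix V V ℝ) c - A).PosSemidef := by
    rw [hB.posSemidef_iff_eigenvalues_nonneg]
    intro i
    have h := hB.eigenvalues_mem_spectrum_real i
    rw [← spectrum.singleton_sub_eq, hA.spectrum_real_eq_range_eigenvalues] at h
    obtain ⟨_, rfl, _, ⟨j, rfl⟩, h⟩ := h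
    simp only [Pi.zero_apply]
    rw [← h]
    exact sub_nonneg.2 (hc j)
  have := hpsd.dotProduct_mulVec_nonneg x
  rw [sub_mulVec, dotProduct_sub, Algebra.algebraMap_eq_smul_one, smul_mulVec, one_mulVec,
    dotProduct_smul, smul_eq_mul] at this
  simpa using this

theorem le_dotProduct_mulVec (hA : A.IsHermitian) {c : ℝ} (hc : ∀ i, c ≤ hA.eigenvalues i)
    (x : V → ℝ) : c * (x ⬝ᵥ x) ≤ x ⬝ᵥ A *ᵥ x := by
  have hB : (A - algebraMap ℝ (Matrix V V ℝ) c).IsHermitian := by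
    refine IsHermitian.sub hA ?_
    simp [Matrix.IsHermitian, Matrix.algebraMap_eq_diagonal]
  have hpsd : (A - algebraMap ℝ (Matrix V V ℝ) c).PosSemidef := by
    rw [hB.posSemidef_iff_eigenvalues_nonneg]
    intro i
    have h := hB.eigenvalues_mem_spectrum_real i
    rw [← spectrum.sub_singleton_eq, hA.spectrum_real_eq_range_eigenvalues] at h
    obtain ⟨_, ⟨j, rfl⟩, _, rfl, h⟩ := h
    simp only [Pi.zero_apply]
    rw [← h]
    exact sub_nonneg.2 (hc j)
  have := hpsd.dotProduct_mulVec_nonneg x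
  rw [sub_mulVec, dotProduct_sub, Algebra.algebraMap_eq_smul_one, smul_mulVec, one_mulVec,
    dotProduct_smul, smul_eq_mul] at this
  simpa using this

theorem isBounded_spectrum (hA : A.IsHermitian) : Bornology.IsBounded (spectrum ℝ A) := by
  rw [hA.spectrum_real_eq_range_eigenvalues]
  exact (Set.finite_range _).isBounded

/-- Two test vectors of equal norm bound the diameter of the spectrum from below. -/
theorem dotProduct_sub_le_diam_spectrum (hA : A.IsHermitian) {x y : V → ℝ} {N : ℝ}
    (hx : x ⬝ᵥ x = N) (hy : y ⬝ᵥ y = N) :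
    x ⬝ᵥ A *ᵥ x - y ⬝ᵥ A *ᵥ y ≤ N * Metric.diam (spectrum ℝ A) := by
  rcases isEmpty_or_nonempty V with hV | hV
  · have : N = 0 := by rw [← hx]; simp [dotProduct]
    simp [dotProduct, this]
  obtain ⟨i, hi⟩ := Finite.exists_max hA.eigenvalues
  obtain ⟨j, hj⟩ := Finite.exists_min hA.eigenvalues
  have h1 := hA.dotProduct_mulVec_le hi x
  have h2 := hA.le_dotProduct_mulVec hj y
  have hN : 0 ≤ N := by
    rw [← hx]; exact Finset.sum_nonneg fun i _ => mul_self_nonneg _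
  have h3 : hA.eigenvalues i - hA.eigenvalues j ≤ Metric.diam (spectrum ℝ A) :=
    (le_abs_self _).trans (Metric.dist_le_diam_of_mem hA.isBounded_spectrum
      (hA.eigenvalues_mem_spectrum_real i) (hA.eigenvalues_mem_spectrum_real j))
  rw [hx] at h1
  rw [hy] at h2
  nlinarith [mul_le_mul_of_nonneg_left h3 hN]

/-- Two eigenvalues satisfy `(a - b) ^ k ≤ 2 ^ (k - 1) (a ^ k + b ^ k)` for even `k`, and the
remaining eigenvalues only add to the trace. -/
theorem diam_spectrum_pow_le (hA : A.IsHermitian) {k : ℕ} (hk : Even k) (hk0 : k ≠ 0) :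
    Metric.diam (spectrum ℝ A) ^ k ≤ 2 ^ (k - 1) * (A ^ k).trace := by
  set t := (A ^ k).trace with ht
  rw [hA.trace_pow_eq_sum_eigenvalues] at ht
  have ht0 : 0 ≤ t := ht ▸ Finset.sum_nonneg fun i _ => hk.pow_nonneg _
  have hroot : (0 : ℝ) ≤ (2 ^ (k - 1) * t) ^ ((k : ℝ)⁻¹) := by positivity
  have hpow : ((2 ^ (k - 1) * t) ^ ((k : ℝ)⁻¹)) ^ k = 2 ^ (k - 1) * t :=
    Real.rpow_inv_natCast_pow (by positivity) hk0
  rw [← hpow]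
  refine pow_le_pow_left₀ Metric.diam_nonneg (Metric.diam_le_of_forall_dist_le hroot ?_) k
  rw [hA.spectrum_real_eq_range_eigenvalues]
  rintro _ ⟨i, rfl⟩ _ ⟨j, rfl⟩
  refine le_of_pow_le_pow_left₀ hk0 hroot ?_
  rw [hpow, Real.dist_eq, hk.pow_abs]
  by_cases hij : i = j
  · subst hij
    rw [sub_self, zero_pow hk0]
    positivity
  have h2 : hA.eigenvalues i ^ k + hA.eigenvalues j ^ k ≤ t := by
    rw [ht, ← Finset.sum_pair (f := fun i => hA.eigenvalues i ^ k) hij]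
    exact Finset.sum_le_sum_of_subset_of_nonneg (Finset.subset_univ _)
      fun i _ _ => hk.pow_nonneg _
  refine le_trans ?_ (mul_le_mul_of_nonneg_left h2 (by positivity))
  have := Even.add_pow_le hk (a := hA.eigenvalues i) (b := -hA.eigenvalues j)
  rwa [← sub_eq_add_neg, hk.neg_pow] at this

end Matrix.IsHermitian

/-! ### Bounds for the spread of a graph -/

section Spread

variable {V : Type*} (G : SimpleGraph V)

theorem ncard_edgeSet_eq_card [Fintype G.edgeSet] : G.edgeSet.ncard = #G.edgeFinset := by
  rw [Set.ncard_eq_toFinset_card', SimpleGraph.edgeFinset]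

variable [Fintype V]

theorem graphSpread_eq [DecidableEq V] [DecidableRel G.Adj] :
    graphSpread G = Metric.diam (spectrum ℝ (G.adjMatrix ℝ)) := by
  unfold graphSpread
  congr!

theorem graphSpread_nonneg : 0 ≤ graphSpread G := Metric.diam_nonneg

theorem graphSpread_sq_le : graphSpread G ^ 2 ≤ 4 * G.edgeSet.ncard := by
  classical
  rw [graphSpread_eq, ncard_edgeSet_eq_card]
  refine ((G.isHermitian_adjMatrix ℝ).diam_spectrum_pow_le even_two two_ne_zero).trans_eq ?_
  have h : ((G.adjMatrix ℝ) ^ 2).trace = 2 * #G.edgeFinset := by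
    rw [sq, Matrix.trace]
    simp only [Matrix.diag_apply, SimpleGraph.adjMatrix_mul_self_apply_self]
    exact_mod_cast G.sum_degrees_eq_twice_card_edges
  rw [h]
  ring

/-- The test vectors `1_P / √|P| ± 1_Q / √|Q|` bound the spread from below by the number of
edges between `P` and `Q`; edges inside `P` or `Q` contribute equally to both quadratic forms. -/
theorem two_mul_sum_le_graphSpread [DecidableEq V] [DecidableRel G.Adj] {P Q : Finset V}
    (hPQ : Disjoint P Q) (hP : P.Nonempty) (hQ : Q.Nonempty) :
    2 * ∑ i ∈ P, ∑ j ∈ Q, G.adjMatrix ℝ i j ≤ √(#P * #Q) * graphSpread G := by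
  rw [graphSpread_eq]
  set A := G.adjMatrix ℝ with hAdef
  have hA : A.IsHermitian := G.isHermitian_adjMatrix ℝ
  have hp : (0 : ℝ) < #P := by exact_mod_cast hP.card_pos
  have hq : (0 : ℝ) < #Q := by exact_mod_cast hQ.card_pos
  set u : V → ℝ := fun i => if i ∈ P then (√(#P))⁻¹ else 0 with hu
  set v : V → ℝ := fun i => if i ∈ Q then (√(#Q))⁻¹ else 0 with hv
  have huu : u ⬝ᵥ u = 1 := by
    simp only [dotProduct, hu, mul_ite, ite_mul, mul_zero, zero_mul]
    rw [Finset.sum_congr rfl (g := fun i => if i ∈ P then (√(#P))⁻¹ * (√(#P))⁻¹ else 0)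
      (fun i _ => by split_ifs <;> rfl)]
    rw [Finset.sum_ite_mem, univ_inter, sum_const, nsmul_eq_mul, ← mul_inv, Real.mul_self_sqrt hp.le]
    field_simp
  have hvv : v ⬝ᵥ v = 1 := by
    simp only [dotProduct, hv, mul_ite, ite_mul, mul_zero, zero_mul]
    rw [Finset.sum_congr rfl (g := fun i => if i ∈ Q then (√(#Q))⁻¹ * (√(#Q))⁻¹ else 0)
      (fun i _ => by split_ifs <;> rfl)]
    rw [Finset.sum_ite_mem, univ_inter, sum_const, nsmul_eq_mul, ← mul_inv, Real.mul_self_sqrt hq.le]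
    field_simp
  have huv : u ⬝ᵥ v = 0 := by
    refine Finset.sum_eq_zero fun i _ => ?_
    simp only [hu, hv]
    split_ifs with h1 h2
    · exact absurd h2 (Finset.disjoint_left.1 hPQ h1)
    all_goals simp
  have hvu : v ⬝ᵥ u = 0 := by rw [dotProduct_comm, huv]
  have hAuv : u ⬝ᵥ A.mulVec v = (√(#P * #Q))⁻¹ * ∑ i ∈ P, ∑ j ∈ Q, A i j := by
    simp only [dotProduct, Matrix.mulVec, hu, hv, mul_ite, ite_mul, mul_zero, zero_mul,
      Finset.sum_ite_mem, univ_inter]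
    rw [Real.sqrt_mul hp.le, mul_inv, Finset.mul_sum]
    refine Finset.sum_congr rfl fun i _ => ?_
    rw [← Finset.sum_mul]
    ring
  have hAvu : v ⬝ᵥ A.mulVec u = u ⬝ᵥ A.mulVec v := by
    rw [Matrix.dotProduct_mulVec, dotProduct_comm, ← Matrix.mulVec_transpose,
      SimpleGraph.transpose_adjMatrix]
  have key := hA.dotProduct_sub_le_diam_spectrum (x := u + v) (y := u - v) (N := 2)
    (by simp only [add_dotProduct, dotProduct_add, huu, hvv, huv, hvu]; norm_num)
    (by simp only [sub_dotProduct, dotProduct_sub, huu, hvv, huv, hvu]; norm_num)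
  simp only [Matrix.mulVec_add, Matrix.mulVec_sub, add_dotProduct, dotProduct_add,
    sub_dotProduct, dotProduct_sub, hAvu] at key
  have hs : 0 < √((#P : ℝ) * #Q) := by positivity
  have key2 : 2 * ((√((#P : ℝ) * #Q))⁻¹ * ∑ i ∈ P, ∑ j ∈ Q, A i j) ≤ Metric.diam (spectrum ℝ A) := by
    rw [← hAuv]; linarith
  calc 2 * ∑ i ∈ P, ∑ j ∈ Q, A i j
      = √(#P * #Q) * (2 * ((√((#P : ℝ) * #Q))⁻¹ * ∑ i ∈ P, ∑ j ∈ Q, A i j)) := by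
        field_simp
    _ ≤ _ := mul_le_mul_of_nonneg_left key2 hs.le

theorem sum_adjMatrix_of_isBipartiteWith [DecidableRel G.Adj] {P Q : Finset V}
    (h : G.IsBipartiteWith P Q) :
    ∑ i ∈ P, ∑ j ∈ Q, G.adjMatrix ℝ i j = G.edgeSet.ncard := by
  classical
  rw [ncard_edgeSet_eq_card, ← SimpleGraph.isBipartiteWith_sum_degrees_eq_card_edges h, Nat.cast_sum]
  refine Finset.sum_congr rfl fun i hi => ?_
  rw [← SimpleGraph.card_neighborFinset_eq_degree, SimpleGraph.isBipartiteWith_neighborFinset h hi]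
  simp [SimpleGraph.adjMatrix_apply]

end Spread

/-! ### Closed walks of length four in bipartite graphs -/

section ZeroOneMatrix

variable {ι κ : Type*} [Fintype ι] [Fintype κ]

/-- An entry `(i, j)` lies in a row and a column which share only that entry. -/
theorem row_add_col_le_sum [DecidableEq ι] {Z : Matrix ι κ ℝ} (hZ : ∀ i j, 0 ≤ Z i j)
    (i : ι) (j : κ) :
    ∑ j', Z i j' + ∑ i', Z i' j ≤ ∑ i', ∑ j', Z i' j' + Z i j := by
  have h1 := Finset.add_sum_erase univ (fun i' => ∑ j', Z i' j') (mem_univ i)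
  have h2 := Finset.add_sum_erase univ (fun i' => Z i' j) (mem_univ i)
  have h3 : ∑ i' ∈ univ.erase i, Z i' j ≤ ∑ i' ∈ univ.erase i, ∑ j', Z i' j' :=
    Finset.sum_le_sum fun i' _ =>
      Finset.single_le_sum (f := fun j' => Z i' j') (fun j' _ => hZ i' j') (mem_univ j)
  linarith

/-- A `0`-`1` matrix with `r` zeros and at least `M` rows and columns has at least
`2 r M (M - r - 1) - r ^ 2` pairs of ones which do not span an all-ones `2 × 2` pattern: every zero
spoils almost all of the patterns through it. -/
theorem trace_sq_mul_transpose_le [DecidableEq ι] {B : Matrix ι κ ℝ}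
    (hB : ∀ i j, B i j = 0 ∨ B i j = 1)
    {e r M : ℝ} (he : ∑ i, ∑ j, B i j = e) (hr : r = Fintype.card ι * Fintype.card κ - e)
    (hι : M ≤ Fintype.card ι) (hκ : M ≤ Fintype.card κ) (hM : r + 1 ≤ M) :
    (B * B.transpose * (B * B.transpose)).trace ≤ e ^ 2 - 2 * (r * (M * (M - r - 1))) + r ^ 2 := by
  set Z : Matrix ι κ ℝ := fun i j => 1 - B i j with hZdef
  have hZ0 : ∀ i j, 0 ≤ Z i j := fun i j => by
    rcases hB i j with h | h <;> simp [hZdef, h]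
  have hZsum : ∑ i, ∑ j, Z i j = r := by
    simp [hZdef, he, hr]
  have htr : (B * B.transpose * (B * B.transpose)).trace
      = ∑ i, ∑ i', ∑ j, ∑ j', B i j * B i' j * (B i' j' * B i j') := by
    simp only [Matrix.trace, Matrix.diag_apply]
    refine Finset.sum_congr rfl fun i _ => ?_
    rw [Matrix.mul_apply]
    refine Finset.sum_congr rfl fun i' _ => ?_
    rw [Matrix.mul_apply, Matrix.mul_apply, Finset.sum_mul_sum]
    rfl
  -- Pairs of ones `(i, j)`, `(i', j')` such that the position `(i, j')` is a zero.
  set S : ℝ := ∑ i, ∑ i', ∑ j, ∑ j', B i j * B i' j' * Z i j' with hS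
  have hS' : ∑ i, ∑ i', ∑ j, ∑ j', B i j * B i' j' * Z i' j = S := by
    rw [hS, Finset.sum_comm]
    refine Finset.sum_congr rfl fun i _ => Finset.sum_congr rfl fun i' _ => ?_
    rw [Finset.sum_comm]
    exact Finset.sum_congr rfl fun j _ => Finset.sum_congr rfl fun j' _ => by ring
  have he2 : ∑ i, ∑ i', ∑ j, ∑ j', B i j * B i' j' = e ^ 2 := by
    rw [sq, ← he, Finset.sum_mul_sum]
    exact Finset.sum_congr rfl fun i _ => Finset.sum_congr rfl fun i' _ =>
      (Finset.sum_mul_sum _ _ _ _).symm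
  have hr2 : ∑ i, ∑ i', ∑ j, ∑ j', Z i' j * Z i j' = r ^ 2 := by
    rw [sq, ← hZsum, Finset.sum_mul_sum, Finset.sum_comm]
    exact Finset.sum_congr rfl fun i _ => Finset.sum_congr rfl fun i' _ =>
      (Finset.sum_mul_sum _ _ _ _).symm
  have hmain : (B * B.transpose * (B * B.transpose)).trace + 2 * S ≤ e ^ 2 + r ^ 2 := by
    rw [htr, two_mul, ← he2, ← hr2]
    nth_rewrite 2 [← hS']
    rw [hS]
    simp only [← Finset.sum_add_distrib]
    refine Finset.sum_le_sum fun i _ => Finset.sum_le_sum fun i' _ =>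
      Finset.sum_le_sum fun j _ => Finset.sum_le_sum fun j' _ => ?_
    rcases hB i j with h1 | h1 <;> rcases hB i' j with h2 | h2 <;> rcases hB i' j' with h3 | h3 <;>
      rcases hB i j' with h4 | h4 <;> norm_num [hZdef, h1, h2, h3, h4]
  have hSval : S = ∑ i, ∑ j', Z i j' * ((∑ j, B i j) * ∑ i', B i' j') := by
    rw [hS]
    refine Finset.sum_congr rfl fun i _ => ?_
    simp_rw [Finset.sum_mul_sum, Finset.mul_sum]
    rw [Finset.sum_congr rfl fun i' _ => Finset.sum_comm, Finset.sum_comm]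
    refine Finset.sum_congr rfl fun j' _ => ?_
    rw [Finset.sum_comm]
    exact Finset.sum_congr rfl fun j _ => Finset.sum_congr rfl fun i' _ => by ring
  have hSge : r * (M * (M - r - 1)) ≤ S := by
    rw [hSval, ← hZsum, Finset.sum_mul]
    refine Finset.sum_le_sum fun i _ => ?_
    rw [Finset.sum_mul]
    refine Finset.sum_le_sum fun j _ => ?_
    rcases hB i j with h | h
    · have hZij : Z i j = 1 := by simp [hZdef, h]
      have hrc := row_add_col_le_sum hZ0 i j
      rw [hZsum, hZij] at hrc
      have hrow : ∑ j', B i j' = Fintype.card κ - ∑ j', Z i j' := by simp [hZdef]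
      have hcol : ∑ i', B i' j = Fintype.card ι - ∑ i', Z i' j := by simp [hZdef]
      have ha : 0 ≤ ∑ j', Z i j' := Finset.sum_nonneg fun _ _ => hZ0 _ _
      have hb : 0 ≤ ∑ i', Z i' j := Finset.sum_nonneg fun _ _ => hZ0 _ _
      rw [hZsum, hZij, one_mul, one_mul, hrow, hcol]
      set a := ∑ j', Z i j'
      set b := ∑ i', Z i' j
      have h1 : (M - a) * (M - b) ≤ (Fintype.card κ - a) * (Fintype.card ι - b) :=
        mul_le_mul (by linarith) (by linarith) (by linarith) (by linarith)
      nlinarith [mul_nonneg ha hb, mul_nonneg (show 0 ≤ M by linarith)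
        (show 0 ≤ r + 1 - (a + b) by linarith)]
    · simp [hZdef, h]
  linarith

end ZeroOneMatrix

theorem trace_fromBlocks_pow_four {ι κ : Type*} [Fintype ι] [Fintype κ] [DecidableEq ι]
    [DecidableEq κ] (B : Matrix ι κ ℝ) :
    ((Matrix.fromBlocks 0 B B.transpose 0) ^ 4).trace
      = 2 * (B * B.transpose * (B * B.transpose)).trace := by
  rw [show 4 = 2 * 2 from rfl, pow_mul, sq, sq, Matrix.fromBlocks_multiply]
  have h : (B.transpose * B * (B.transpose * B)).trace
      = (B * B.transpose * (B * B.transpose)).trace := by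
    rw [Matrix.mul_assoc, Matrix.trace_mul_comm, ← Matrix.mul_assoc, ← Matrix.mul_assoc]
  simp only [Matrix.trace, Matrix.diag_apply] at h
  simp only [Matrix.mul_zero, Matrix.zero_mul, zero_add, add_zero, Matrix.fromBlocks_multiply,
    Matrix.trace, Matrix.diag_apply, Fintype.sum_sum_type, Matrix.fromBlocks_apply₁₁,
    Matrix.fromBlocks_apply₂₂, h]
  ring

/-- The spread of a bipartite graph missing `r` edges from a complete bipartite graph whose
parts both have at least `M` vertices. -/
theorem SimpleGraph.IsBipartite.graphSpread_pow_four_le {V : Type*} [Fintype V]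
    {G : SimpleGraph V} (hG : G.IsBipartite) :
    ∃ p q : ℕ, p + q = Fintype.card V ∧ G.edgeSet.ncard ≤ p * q ∧ ∀ r M : ℝ,
      r = p * q - G.edgeSet.ncard → M ≤ p → M ≤ q → r + 1 ≤ M →
      graphSpread G ^ 4 ≤
        16 * ((G.edgeSet.ncard : ℝ) ^ 2 - 2 * (r * (M * (M - r - 1))) + r ^ 2) := by
  classical
  obtain ⟨C⟩ := hG
  set f : V → Prop := fun v => C v = 0 with hf
  have hadj : ∀ i j, G.Adj i j → (f i ↔ ¬ f j) := by
    intro i j hij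
    have := C.valid hij
    simp only [hf]
    omega
  set A := G.adjMatrix ℝ with hAdef
  set B : Matrix {v // f v} {v // ¬ f v} ℝ := Matrix.of fun i j => A i j with hBdef
  have hB : ∀ i j, B i j = 0 ∨ B i j = 1 := fun i j => by
    simp only [hBdef, hAdef, Matrix.of_apply, SimpleGraph.adjMatrix_apply]
    split_ifs <;> simp
  have he : ∑ i, ∑ j, B i j = (G.edgeSet.ncard : ℝ) := by
    have hbip : G.IsBipartiteWith (↑(univ.filter f) : Set V) ↑(univ.filter fun v => ¬ f v) := by
      refine ⟨?_, fun v w hvw => ?_⟩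
      · rw [Finset.disjoint_coe]
        exact Finset.disjoint_filter_filter_not _ _ _
      · have := hadj v w hvw
        simp only [coe_filter, mem_univ, true_and, Set.mem_ofPred_eq]
        tauto
    rw [← sum_adjMatrix_of_isBipartiteWith G hbip,
      Finset.sum_subtype (univ.filter f) (p := f) (by simp)]
    exact Finset.sum_congr rfl fun i _ =>
      (Finset.sum_subtype (univ.filter fun v => ¬ f v) (p := fun v => ¬ f v) (by simp)
        (A i)).symm
  have hblock : A.submatrix (Equiv.sumCompl f) (Equiv.sumCompl f)
      = Matrix.fromBlocks 0 B B.transpose 0 := by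
    ext (i | i) (j | j)
    · simp only [Matrix.submatrix_apply, Equiv.sumCompl_apply_inl, Matrix.fromBlocks_apply₁₁,
        Matrix.zero_apply, hAdef, SimpleGraph.adjMatrix_apply, ite_eq_right_iff]
      intro h
      exact absurd j.2 ((hadj _ _ h).1 i.2)
    · simp [hBdef]
    · simp [hBdef, hAdef, SimpleGraph.adjMatrix_apply, Matrix.transpose_apply, G.adj_comm]
    · simp only [Matrix.submatrix_apply, Equiv.sumCompl_apply_inr, Matrix.fromBlocks_apply₂₂,
        Matrix.zero_apply, hAdef, SimpleGraph.adjMatrix_apply, ite_eq_right_iff]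
      intro h
      exact absurd ((hadj _ _ h).2 j.2) i.2
  have htr : (A ^ 4).trace = 2 * (B * B.transpose * (B * B.transpose)).trace := by
    rw [← trace_fromBlocks_pow_four, ← hblock]
    have : A.submatrix (Equiv.sumCompl f) (Equiv.sumCompl f)
        = Matrix.reindexAlgEquiv ℝ ℝ (Equiv.sumCompl f).symm A := rfl
    rw [this, ← map_pow]
    exact (Equiv.sum_comp (Equiv.sumCompl f) fun i => (A ^ 4) i i).symm
  have hspread : graphSpread G ^ 4 ≤ 16 * (B * B.transpose * (B * B.transpose)).trace := by
    rw [graphSpread_eq]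
    refine ((G.isHermitian_adjMatrix ℝ).diam_spectrum_pow_le (k := 4) (by decide)
      (by decide)).trans_eq ?_
    rw [htr]
    ring
  refine ⟨Fintype.card {v // f v}, Fintype.card {v // ¬ f v}, ?_, ?_, ?_⟩
  · rw [← Fintype.card_sum, Fintype.card_congr (Equiv.sumCompl f)]
  · have : (G.edgeSet.ncard : ℝ) ≤ Fintype.card {v // f v} * Fintype.card {v // ¬ f v} := by
      rw [← he]
      calc ∑ i, ∑ j, B i j ≤ ∑ _i : {v // f v}, ∑ _j : {v // ¬ f v}, (1 : ℝ) :=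
            Finset.sum_le_sum fun i _ => Finset.sum_le_sum fun j _ => by
              rcases hB i j with h | h <;> simp [h]
        _ = _ := by simp
    exact_mod_cast this
  · intro r M hr hp hq hM
    exact hspread.trans (mul_le_mul_of_nonneg_left
      (trace_sq_mul_transpose_le hB he hr hp hq hM) (by norm_num))

/-! ### Graphs with large spread -/

theorem exists_isBipartiteWith_ncard_edgeSet_eq {n p q e : ℕ} (hpq : p + q ≤ n) (he : e ≤ p * q) :
    ∃ (G : SimpleGraph (Fin n)) (P Q : Finset (Fin n)),
      #P = p ∧ #Q = q ∧ G.IsBipartiteWith P Q ∧ G.edgeSet.ncard = e := by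
  classical
  obtain ⟨P, -, hP⟩ := Finset.exists_subset_card_eq (s := (univ : Finset (Fin n))) (n := p)
    (by simp; omega)
  obtain ⟨Q, hQP, hQ⟩ := Finset.exists_subset_card_eq (s := Pᶜ) (n := q)
    (by rw [card_compl, Fintype.card_fin]; omega)
  have hdisj : Disjoint (P : Set (Fin n)) Q := by
    rw [Finset.disjoint_coe]
    exact (Finset.disjoint_of_subset_left hQP disjoint_compl_left).symm
  set H : SimpleGraph (Fin n) := (⊤ : SimpleGraph (Fin n)).between P Q with hH
  have hbip : H.IsBipartiteWith P Q := SimpleGraph.between_isBipartiteWith hdisj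
  have hcard : H.edgeSet.ncard = p * q := by
    have h := sum_adjMatrix_of_isBipartiteWith H hbip
    have h1 : ∑ i ∈ P, ∑ j ∈ Q, H.adjMatrix ℝ i j = ∑ i ∈ P, ∑ j ∈ Q, 1 := by
      refine Finset.sum_congr rfl fun i hi => Finset.sum_congr rfl fun j hj => ?_
      have hij : i ≠ j := fun hij => (Finset.disjoint_left.1 (Finset.disjoint_coe.1 hdisj) hi)
        (hij ▸ hj)
      rw [SimpleGraph.adjMatrix_apply, if_pos]
      rw [hH, SimpleGraph.between_adj]
      exact ⟨hij, Or.inl ⟨hi, hj⟩⟩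
    rw [h1] at h
    simp only [sum_const, hP, hQ, nsmul_eq_mul, mul_one] at h
    exact_mod_cast h.symm
  obtain ⟨S, hS, hSe⟩ := Finset.exists_subset_card_eq (s := H.edgeFinset) (n := e)
    (by rwa [← ncard_edgeSet_eq_card, hcard])
  have hSH : (S : Set (Sym2 (Fin n))) ⊆ H.edgeSet := fun x hx => by
    simpa using hS hx
  have hedge : (SimpleGraph.fromEdgeSet (S : Set (Sym2 (Fin n)))).edgeSet = S := by
    rw [SimpleGraph.edgeSet_fromEdgeSet]
    refine sdiff_eq_left.2 (Set.disjoint_left.2 fun x hx hd => ?_)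
    exact H.not_isDiag_of_mem_edgeSet (hSH hx) hd
  refine ⟨SimpleGraph.fromEdgeSet S, P, Q, hP, hQ, ⟨hdisj, fun v w hvw => ?_⟩, ?_⟩
  · have hle : SimpleGraph.fromEdgeSet (S : Set (Sym2 (Fin n))) ≤ H := by
      rw [← SimpleGraph.edgeSet_subset_edgeSet, hedge]
      exact hSH
    exact hbip.mem_of_adj (hle hvw)
  · rw [hedge, Set.ncard_coe_finset, hSe]

theorem graphSpread_le_two_mul_sqrt {V : Type*} [Fintype V] (G : SimpleGraph V) :
    graphSpread G ≤ 2 * √(G.edgeSet.ncard) := by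
  refine le_of_pow_le_pow_left₀ two_ne_zero (by positivity) ?_
  rw [mul_pow, Real.sq_sqrt (by positivity)]
  exact (graphSpread_sq_le G).trans_eq (by norm_num)

theorem graphSpread_le_maxSpread {n : ℕ} (G : SimpleGraph (Fin n)) :
    graphSpread G ≤ maxSpread n G.edgeSet.ncard := by
  refine le_csSup ⟨2 * √(G.edgeSet.ncard), ?_⟩ ⟨G, rfl, rfl⟩
  rintro _ ⟨H, hH, rfl⟩
  exact hH ▸ graphSpread_le_two_mul_sqrt H

theorem SimpleGraph.IsBipartite.graphSpread_le_maxBipartiteSpread {n : ℕ}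
    {G : SimpleGraph (Fin n)} (hG : G.IsBipartite) :
    graphSpread G ≤ maxBipartiteSpread n G.edgeSet.ncard := by
  refine le_csSup ⟨2 * √(G.edgeSet.ncard), ?_⟩ ⟨G, hG, rfl, rfl⟩
  rintro _ ⟨H, -, hH, rfl⟩
  exact hH ▸ graphSpread_le_two_mul_sqrt H

theorem maxSpread_le (n e : ℕ) : maxSpread n e ≤ 2 * √e := by
  refine Real.sSup_le ?_ (by positivity)
  rintro _ ⟨H, hH, rfl⟩
  exact hH ▸ graphSpread_le_two_mul_sqrt H

theorem maxSpread_nonneg (n e : ℕ) : 0 ≤ maxSpread n e := by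
  refine Real.sSup_nonneg ?_
  rintro _ ⟨H, -, rfl⟩
  exact graphSpread_nonneg H

theorem maxBipartiteSpread_le_maxSpread (n e : ℕ) : maxBipartiteSpread n e ≤ maxSpread n e := by
  refine Real.sSup_le ?_ (maxSpread_nonneg n e)
  rintro _ ⟨H, -, rfl, rfl⟩
  exact graphSpread_le_maxSpread H

theorem two_mul_le_sqrt_mul_maxBipartiteSpread {n p q e : ℕ} (hp : 0 < p) (hq : 0 < q)
    (hpq : p + q ≤ n) (he : e ≤ p * q) :
    2 * (e : ℝ) ≤ √(p * q) * maxBipartiteSpread n e := by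
  classical
  obtain ⟨G, P, Q, rfl, rfl, hG, rfl⟩ := exists_isBipartiteWith_ncard_edgeSet_eq hpq he
  have h := two_mul_sum_le_graphSpread G (Finset.disjoint_coe.1 hG.disjoint)
    (card_pos.1 hp) (card_pos.1 hq)
  rw [sum_adjMatrix_of_isBipartiteWith G hG] at h
  exact h.trans (mul_le_mul_of_nonneg_left hG.isBipartite.graphSpread_le_maxBipartiteSpread
    (Real.sqrt_nonneg _))

/-- Adding an edge inside a part of `K_{p,q}` does not decrease the spread. -/
theorem two_mul_sqrt_le_maxSpread {n p q : ℕ} (hp : 2 ≤ p) (hq : 0 < q) (hpq : p + q ≤ n) :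
    2 * √((p : ℝ) * q) ≤ maxSpread n (p * q + 1) := by
  classical
  obtain ⟨H, P, Q, hP, hQ, hH, hcard⟩ := exists_isBipartiteWith_ncard_edgeSet_eq hpq le_rfl
  obtain ⟨a, ha, b, hb, hab⟩ := Finset.one_lt_card.1 (show 1 < #P by omega)
  have hnadj : ¬ H.Adj a b := fun h =>
    Finset.disjoint_left.1 (Finset.disjoint_coe.1 hH.disjoint) hb (hH.mem_of_mem_adj ha h)
  set G := H ⊔ SimpleGraph.edge a b with hG
  have hGcard : G.edgeSet.ncard = p * q + 1 := by
    rw [← hcard, ncard_edgeSet_eq_card, ncard_edgeSet_eq_card]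
    exact H.card_edgeFinset_sup_edge hnadj hab
  have h := two_mul_sum_le_graphSpread G (Finset.disjoint_coe.1 hH.disjoint)
    (card_pos.1 (by omega)) (card_pos.1 (by omega))
  have hle : ((p : ℝ) * q) ≤ ∑ i ∈ P, ∑ j ∈ Q, G.adjMatrix ℝ i j := by
    have h1 := sum_adjMatrix_of_isBipartiteWith H hH
    rw [hcard] at h1
    push_cast at h1
    rw [← h1]
    refine Finset.sum_le_sum fun i _ => Finset.sum_le_sum fun j _ => ?_
    rw [SimpleGraph.adjMatrix_apply, SimpleGraph.adjMatrix_apply]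
    split_ifs with h2 h3 <;> try norm_num
    exact h3 (Or.inl h2)
  rw [hP, hQ] at h
  have hs : 0 < √((p : ℝ) * q) := by positivity
  have hsq : √((p : ℝ) * q) * √((p : ℝ) * q) = p * q := Real.mul_self_sqrt (by positivity)
  rw [← hGcard]
  refine le_trans ?_ (graphSpread_le_maxSpread G)
  refine le_of_mul_le_mul_left ?_ hs
  linarith

/-! ### Products close to a given number of edges -/

theorem exists_sq_add_mul_le_lt (c X : ℕ) :
    ∃ k : ℕ, k * (k + c) ≤ X ∧ X < (k + 1) * (k + 1 + c) := by
  have hlt : X < (X + 1) * (X + 1 + c) := by nlinarith [Nat.zero_le (X * c)]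
  refine ⟨Nat.findGreatest (fun k => k * (k + c) ≤ X) X,
    Nat.findGreatest_spec (P := fun k => k * (k + c) ≤ X) (Nat.zero_le X) (by simp), ?_⟩
  by_contra! hle
  rcases Nat.lt_or_ge X (Nat.findGreatest (fun k => k * (k + c) ≤ X) X + 1) with h | h
  · have := Nat.findGreatest_le (P := fun k => k * (k + c) ≤ X) X
    have heq : Nat.findGreatest (fun k => k * (k + c) ≤ X) X = X := by omega
    rw [heq] at hle
    omega
  · exact Nat.findGreatest_is_greatest (Nat.lt_succ_self _) h hle

/-- Among the products `p q` with `p + q ≤ n`, one exceeds `e` by at most `2 e ^ (1 / 4)`. Take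
`p + q` minimal with `e ≤ (p + q) ^ 2 / 4`, then `|p - q|` maximal with `e ≤ p q`. -/
theorem exists_mul_close {n e : ℕ} (he : 1 ≤ e) (hen : e ≤ n ^ 2 / 4) :
    ∃ p q r : ℕ, 0 < p ∧ 0 < q ∧ p + q ≤ n ∧ p * q = e + r ∧ r ^ 4 ≤ 16 * e := by
  classical
  -- The sum `2 m + c` with `c ≤ 1`.
  obtain ⟨m, c, hc, hsum, hub, hlb⟩ : ∃ m c : ℕ, c ≤ 1 ∧ 2 * m + c ≤ n ∧ e ≤ m * (m + c) ∧
      m * (m + c) + 1 ≤ e + m := by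
    have hex : ∃ s : ℕ, e ≤ s ^ 2 / 4 := ⟨n, hen⟩
    have hspec := Nat.find_spec hex
    have hmin : Nat.find hex ≤ n := Nat.find_min' hex hen
    have hpos : Nat.find hex ≠ 0 := by
      intro h
      rw [h] at hspec
      simp at hspec
      omega
    have hpred := Nat.find_min hex (Nat.sub_one_lt hpos)
    rcases Nat.even_or_odd' (Nat.find hex) with ⟨m, h | h⟩ <;> rw [h] at hspec hmin hpred hpos
    · refine ⟨m, 0, by omega, by omega, ?_, ?_⟩
      · have : (2 * m) ^ 2 / 4 = m * m := by
          rw [show (2 * m) ^ 2 = 4 * (m * m) by ring]; omega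
        simpa [this] using hspec
      · obtain ⟨k, rfl⟩ : ∃ k, m = k + 1 := ⟨m - 1, by omega⟩
        have : (2 * (k + 1) - 1) ^ 2 / 4 = k * k + k := by
          rw [show 2 * (k + 1) - 1 = 2 * k + 1 by omega,
            show (2 * k + 1) ^ 2 = 4 * (k * k + k) + 1 by ring]; omega
        rw [this] at hpred
        nlinarith
    · refine ⟨m, 1, le_rfl, hmin, ?_, ?_⟩
      · have : (2 * m + 1) ^ 2 / 4 = m * m + m := by
          rw [show (2 * m + 1) ^ 2 = 4 * (m * m + m) + 1 by ring]; omega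
        rw [this] at hspec
        linarith
      · have : (2 * m + 1 - 1) ^ 2 / 4 = m * m := by
          rw [show 2 * m + 1 - 1 = 2 * m by omega, show (2 * m) ^ 2 = 4 * (m * m) by ring]; omega
        rw [this] at hpred
        linarith
  obtain ⟨X, hX⟩ := Nat.exists_eq_add_of_le hub
  obtain ⟨k, hk, hk'⟩ := exists_sq_add_mul_le_lt c X
  have hXm : X + 1 ≤ m := by omega
  have hkm : k < m := by
    by_contra! h
    nlinarith [Nat.zero_le (k * c)]
  obtain ⟨t, rfl⟩ := Nat.exists_eq_add_of_lt hkm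
  refine ⟨k + t + 1 + c + k, t + 1, X - k * (k + c), by omega, by omega, by omega, ?_, ?_⟩
  · zify [hk] at hX ⊢
    linear_combination hX
  · set r := X - k * (k + c) with hr
    have hr1 : r ≤ 2 * k + c := by
      have : (k + 1) * (k + 1 + c) = k * (k + c) + 2 * k + 1 + c := by ring
      omega
    have hcc : c * c = c := by interval_cases c <;> rfl
    set m := k + t + 1
    have h1 : r ^ 2 ≤ 4 * m - 4 + c := by
      have h2 : r ^ 2 ≤ (2 * k + c) ^ 2 := Nat.pow_le_pow_left hr1 2
      have h3 : (2 * k + c) ^ 2 = 4 * (k * (k + c)) + c * c := by ring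
      omega
    have h4 : (r ^ 2) ^ 2 ≤ (4 * m - 4 + c) ^ 2 := Nat.pow_le_pow_left h1 2
    have h5 : (4 * m - 4 + c) ^ 2 ≤ 16 * e := by
      obtain ⟨j, hj⟩ : ∃ j, m = j + 1 := ⟨k + t, rfl⟩
      rw [hj] at hlb ⊢
      rw [show 4 * (j + 1) - 4 + c = 4 * j + c by omega]
      interval_cases c <;> nlinarith
    calc r ^ 4 = (r ^ 2) ^ 2 := by ring
      _ ≤ _ := h4.trans h5

/-- With `m = ⌊n / 2⌋`, `c ∈ {0, 1}` and `e = (m + c + h) (m - h) + 1`, the next product above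
`(m + c + h) (m - h)` is `(m + c + h - 1) (m - h + 1)`, so `p q - e ≥ 2 h - 2`. -/
theorem mul_sub_bounds {m c h p q : ℤ} (hc0 : 0 ≤ c) (hc1 : c ≤ 1) (hh : 1 ≤ h)
    (hpq : p + q = 2 * m + c) (he : (m + c + h) * (m - h) + 1 ≤ p * q) :
    m - h ≤ p ∧ m - h ≤ q ∧ 2 * h - 2 ≤ p * q - ((m + c + h) * (m - h) + 1) ∧
      p * q - ((m + c + h) * (m - h) + 1) ≤ h ^ 2 + h := by
  have hp : m - h + 1 ≤ p := by
    by_contra! hlt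
    obtain ⟨t, ht⟩ : ∃ t, p = m - h - t := ⟨m - h - p, by ring⟩
    have hq : q = m + c + h + t := by linarith
    subst ht hq
    nlinarith [mul_nonneg (show 0 ≤ t by linarith) (show 0 ≤ 2 * h + c + t by linarith)]
  have hq : m - h + 1 ≤ q := by
    by_contra! hlt
    obtain ⟨t, ht⟩ : ∃ t, q = m - h - t := ⟨m - h - q, by ring⟩
    have hp : p = m + c + h + t := by linarith
    subst ht hp
    nlinarith [mul_nonneg (show 0 ≤ t by linarith) (show 0 ≤ 2 * h + c + t by linarith)]
  obtain ⟨a, ha⟩ : ∃ a, p = m - h + 1 + a := ⟨p - (m - h + 1), by ring⟩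
  obtain ⟨b, hb⟩ : ∃ b, q = m - h + 1 + b := ⟨q - (m - h + 1), by ring⟩
  have hab : a + b = c + 2 * h - 2 := by linarith
  have hval : p * q - ((m + c + h) * (m - h) + 1) = c + 2 * h - 2 + a * b := by
    obtain rfl : b = c + 2 * h - 2 - a := by linarith
    rw [ha, hb]
    ring
  have ha0 : 0 ≤ a := by linarith
  have hb0 : 0 ≤ b := by linarith
  refine ⟨by linarith, by linarith, ?_, ?_⟩
  · rw [hval]
    nlinarith [mul_nonneg ha0 hb0]
  · rw [hval]
    have h4 : 4 * (a * b) ≤ (c + 2 * h - 2) ^ 2 := by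
      rw [← hab]
      nlinarith [sq_nonneg (a - b)]
    nlinarith

/-! ### Comparing the two maximum spreads -/

/-- The edge count `e` enters through its fourth root `w`. -/
theorem one_sub_mul_maxSpread_le {n e : ℕ} (he : 1 ≤ e) (hen : e ≤ n ^ 2 / 4) {w : ℝ}
    (hw : 0 < w) (hwe : w ^ 4 = e) :
    (1 - 1 / w ^ 3) * maxSpread n e ≤ maxBipartiteSpread n e := by
  obtain ⟨p, q, r, hp, hq, hpq, hmul, hr⟩ := exists_mul_close he hen
  have hr2 : (r : ℝ) ≤ 2 * w := by
    refine le_of_pow_le_pow_left₀ four_ne_zero (by positivity) ?_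
    rw [mul_pow, hwe]
    norm_num
    exact_mod_cast hr
  have hsqrt : √((p : ℝ) * q) ≤ w ^ 2 + 1 / w := by
    refine Real.sqrt_le_iff.2 ⟨by positivity, ?_⟩
    have h1 : (p : ℝ) * q = w ^ 4 + r := by rw [hwe]; exact_mod_cast hmul
    have h2 : (w ^ 2 + 1 / w) ^ 2 = w ^ 4 + 2 * w + 1 / w ^ 2 := by field_simp; ring
    have h3 : 0 < 1 / w ^ 2 := by positivity
    linarith
  have h := two_mul_le_sqrt_mul_maxBipartiteSpread hp hq hpq (e := e) (by omega)
  have hb0 : 0 ≤ maxBipartiteSpread n e := by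
    have hs : 0 < √((p : ℝ) * q) := by positivity
    exact nonneg_of_mul_nonneg_right (le_trans (by positivity) h) hs
  have hup : maxSpread n e ≤ 2 * w ^ 2 := by
    refine (maxSpread_le n e).trans_eq ?_
    rw [← hwe, show w ^ 4 = (w ^ 2) ^ 2 by ring, Real.sqrt_sq (by positivity)]
  rcases le_or_gt 1 w with h1 | h1
  · have hlow : 2 * w ^ 4 ≤ (w ^ 2 + 1 / w) * maxBipartiteSpread n e := by
      rw [hwe]
      exact h.trans (mul_le_mul_of_nonneg_right hsqrt hb0)
    have hx : 0 ≤ 1 - 1 / w ^ 3 := by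
      rw [sub_nonneg, div_le_one (by positivity)]
      exact one_le_pow₀ h1
    refine (mul_le_mul_of_nonneg_left hup hx).trans ?_
    refine le_of_mul_le_mul_left (le_trans ?_ hlow) (show 0 < w ^ 2 + 1 / w by positivity)
    have : (w ^ 2 + 1 / w) * ((1 - 1 / w ^ 3) * (2 * w ^ 2)) = 2 * w ^ 4 - 2 / w ^ 2 := by
      field_simp
      ring
    rw [this]
    have : 0 < 2 / w ^ 2 := by positivity
    linarith
  · have : w ^ 4 < 1 := pow_lt_one₀ hw.le h1 (by norm_num)
    rw [hwe] at this
    have : (1 : ℝ) ≤ e := by exact_mod_cast he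
    linarith

theorem maxSpread_pos {n e : ℕ} (he : 1 ≤ e) (hen : e ≤ n ^ 2 / 4) : 0 < maxSpread n e := by
  obtain ⟨p, q, r, hp, hq, hpq, hmul, -⟩ := exists_mul_close he hen
  have h := two_mul_le_sqrt_mul_maxBipartiteSpread hp hq hpq (e := e) (by omega)
  have he' : (0 : ℝ) < e := by exact_mod_cast he
  exact (pos_of_mul_pos_right (lt_of_lt_of_le (by positivity) h) (Real.sqrt_nonneg _)).trans_le
    (maxBipartiteSpread_le_maxSpread n e)

/-- With `D` missing pairs of edges and `e = w ^ 4`, the bounds `t` for a bipartite spread and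
`S` for the maximum spread differ by a factor `1 - (1 - ε) e ^ (-3 / 4)`. Bernoulli's inequality
replaces the fourth root of `1 - D / e ^ 2`. -/
theorem le_one_sub_mul_of_pow_four_le {w u D ε t S : ℝ} (hw : 2 ≤ w) (hwu : w ≤ u) (hε0 : 0 < ε)
    (hε1 : ε ≤ 1) (hu : 53 ≤ 4 * ε * u) (hD : 4 * u ^ 5 - 49 * u ^ 4 ≤ D)
    (ht : t ^ 4 ≤ 16 * ((w ^ 4) ^ 2 - D)) (hS : 2 * √(w ^ 4 - 1) ≤ S) :
    t ≤ (1 - (1 - ε) / w ^ 3) * S := by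
  have hw0 : 0 < w := by linarith
  have hu0 : 0 < u := by linarith
  set x := (1 - ε) / w ^ 3 with hx
  set y := 1 / w ^ 4 with hy
  have hx0 : 0 ≤ x := div_nonneg (by linarith) (by positivity)
  have hy0 : 0 ≤ y := by positivity
  have hw3 : 2 ≤ w ^ 3 := by nlinarith [pow_le_pow_left₀ zero_le_two hw 3]
  have hw4 : 2 ≤ w ^ 4 := by nlinarith [pow_le_pow_left₀ zero_le_two hw 4]
  have hx2 : x ≤ 1 / 2 := by
    rw [hx, div_le_div_iff₀ (by positivity) (by norm_num)]
    linarith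
  have hy2 : y ≤ 1 / 2 := one_div_le_one_div_of_le (by norm_num) hw4
  have hsqrt : w ^ 2 * (1 - y) ≤ √(w ^ 4 - 1) := by
    refine Real.le_sqrt_of_sq_le ?_
    have h1 : (w ^ 2 * (1 - y)) ^ 2 = w ^ 4 - 2 + y := by
      rw [hy]; field_simp; ring
    linarith
  have hmain : t ≤ 2 * w ^ 2 * (1 - (x + y)) := by
    refine le_of_pow_le_pow_left₀ four_ne_zero
      (mul_nonneg (by positivity) (by linarith)) (ht.trans ?_)
    have hber : 1 - 4 * (x + y) ≤ (1 - (x + y)) ^ 4 := by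
      have := one_add_mul_le_pow (a := -(x + y)) (by linarith) 4
      push_cast at this
      calc _ = 1 + 4 * -(x + y) := by ring
        _ ≤ _ := this
        _ = _ := by ring
    have hxy : w ^ 8 * (4 * (x + y)) = 4 * (1 - ε) * w ^ 5 + 4 * w ^ 4 := by
      rw [hx, hy]; field_simp
    have h5 : w ^ 5 ≤ u ^ 5 := pow_le_pow_left₀ hw0.le hwu 5
    have h4 : w ^ 4 ≤ u ^ 4 := pow_le_pow_left₀ hw0.le hwu 4
    have hu4 : 53 * u ^ 4 ≤ 4 * ε * u ^ 5 := by
      have := mul_le_mul_of_nonneg_right hu (show 0 ≤ u ^ 4 by positivity)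
      linarith [show 4 * ε * u * u ^ 4 = 4 * ε * u ^ 5 by ring]
    have h6 : w ^ 8 * (4 * (x + y)) ≤ D := by
      rw [hxy]
      nlinarith [mul_le_mul_of_nonneg_left h5 (show 0 ≤ 1 - ε by linarith)]
    have h7 := mul_le_mul_of_nonneg_left hber (show 0 ≤ w ^ 8 by positivity)
    calc 16 * ((w ^ 4) ^ 2 - D) = 16 * (w ^ 8 - D) := by ring
      _ ≤ 16 * (w ^ 8 * (1 - (x + y)) ^ 4) := by linarith
      _ = _ := by ring
  calc t ≤ 2 * w ^ 2 * (1 - (x + y)) := hmain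
    _ ≤ (1 - x) * (2 * (w ^ 2 * (1 - y))) := by
      nlinarith [mul_nonneg (mul_nonneg hx0 hy0) (sq_nonneg w)]
    _ ≤ (1 - x) * S := mul_le_mul_of_nonneg_left (by linarith) (by linarith)

/-! ### An edge count in a gap between products -/

/-- The bound of `trace_sq_mul_transpose_le` for `r` missing edges between parts of at least
`M = m - (s - 2)` vertices, in terms of `s = ⌊√m⌋`: the main term is `4 s ^ 5`. -/
theorem missing_edges_bound {s m r : ℝ} (hs : 3 ≤ s) (hsm : s ^ 2 ≤ m)
    (hr1 : 2 * (s - 2) - 2 ≤ r) (hr2 : r ≤ (s - 2) ^ 2 + (s - 2)) :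
    r + 1 ≤ m - (s - 2) ∧
      4 * (s + 1) ^ 5 - 49 * (s + 1) ^ 4 ≤
        2 * (r * ((m - (s - 2)) * (m - (s - 2) - r - 1))) - r ^ 2 := by
  have hM : s ^ 2 - s ≤ m - (s - 2) := by linarith
  have hs0 : 0 ≤ s ^ 2 - s := by nlinarith
  have hs3 : 0 ≤ s ^ 2 - 3 * s := by nlinarith
  refine ⟨by nlinarith, ?_⟩
  -- `r ↦ r (M - 1 - r)` is concave, hence at least its value at `r = 2 (s - 2) - 2`.
  have hconc : (2 * s - 6) * (s ^ 2 - 3 * s) ≤ r * (m - (s - 2) - r - 1) := by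
    have h1 := mul_nonneg (show 0 ≤ r - (2 * s - 6) by linarith)
      (show 0 ≤ m - (s - 2) - 1 - (2 * s - 6) - r by nlinarith)
    have h2 : (2 * s - 6) * (s ^ 2 - 3 * s) ≤ (2 * s - 6) * (m - (s - 2) - 1 - (2 * s - 6)) :=
      mul_le_mul_of_nonneg_left (by linarith) (by linarith)
    linarith
  have hprod : (s ^ 2 - s) * ((2 * s - 6) * (s ^ 2 - 3 * s))
      ≤ (m - (s - 2)) * (r * (m - (s - 2) - r - 1)) :=
    mul_le_mul hM hconc (mul_nonneg (by linarith) hs3) (by linarith)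
  have hrm : r ^ 2 ≤ (s + 1) ^ 4 := by
    have h : r ≤ (s + 1) ^ 2 := by nlinarith
    calc r ^ 2 ≤ ((s + 1) ^ 2) ^ 2 := pow_le_pow_left₀ (by linarith) h 2
      _ = _ := by ring
  have hpoly : 4 * (s + 1) ^ 5 - 48 * (s + 1) ^ 4
      ≤ 2 * ((s ^ 2 - s) * ((2 * s - 6) * (s ^ 2 - 3 * s))) := by
    have : 0 ≤ 53 * s ^ 3 + 53 * s ^ 2 + 43 * s + 11 := by positivity
    nlinarith
  linarith

/-- For `e = (m + c + h) (m - h) + 1` with `h = s - 2`, every bipartite graph with `2 m + c`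
vertices and `e` edges misses many edges between its parts. -/
theorem SimpleGraph.IsBipartite.graphSpread_pow_four_le_of_card_eq {n m c h s e : ℕ} (hc : c ≤ 1)
    (hn : n = 2 * m + c) (hh : s = h + 2) (hh1 : 1 ≤ h) (hsm : s ^ 2 ≤ m)
    (he : (e : ℤ) = (m + c + h) * (m - h) + 1) {G : SimpleGraph (Fin n)} (hG : G.IsBipartite)
    (hGe : G.edgeSet.ncard = e) :
    graphSpread G ^ 4 ≤
      16 * ((e : ℝ) ^ 2 - (4 * ((s : ℝ) + 1) ^ 5 - 49 * ((s : ℝ) + 1) ^ 4)) := by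
  obtain ⟨p, q, hpq, hle, hbound⟩ := hG.graphSpread_pow_four_le
  rw [hGe] at hle hbound
  rw [Fintype.card_fin] at hpq
  obtain ⟨hp, hq, hr1, hr2⟩ := mul_sub_bounds (m := m) (c := c) (h := h) (p := p) (q := q)
    (by omega) (by omega) (by omega) (by omega) (by rw [← he]; exact_mod_cast hle)
  rw [← he] at hr1 hr2
  have hsh : (h : ℝ) = s - 2 := by rw [hh]; push_cast; ring
  have hpR : (m : ℝ) - h ≤ p := by exact_mod_cast hp
  have hqR : (m : ℝ) - h ≤ q := by exact_mod_cast hq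
  have hr1R : 2 * (h : ℝ) - 2 ≤ p * q - e := by exact_mod_cast hr1
  have hr2R : (p : ℝ) * q - e ≤ h ^ 2 + h := by exact_mod_cast hr2
  rw [hsh] at hpR hqR hr1R hr2R
  have hsmR : (s : ℝ) ^ 2 ≤ m := by exact_mod_cast hsm
  have hs3 : (3 : ℝ) ≤ s := by
    have : 3 ≤ s := by omega
    exact_mod_cast this
  obtain ⟨hb1, hb2⟩ := missing_edges_bound hs3 hsmR hr1R hr2R
  have := hbound _ _ rfl hpR hqR hb1
  linarith

/-- The parameters of the extremal edge count: `h + 2 = s = ⌊√m⌋`, so that `e` lies just above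
`p₀ q₀ = (m + c + h) (m - h)`, nearly as far from the balanced product as the requirement allows
that it exceed all products with a smaller sum. -/
theorem exists_gap_parameters (k : ℕ) {n : ℕ} (hn : 2 * (k + 10) ^ 2 ≤ n) :
    ∃ m c h s p₀ q₀ e : ℕ, c ≤ 1 ∧ n = 2 * m + c ∧ s = h + 2 ∧ 8 ≤ h ∧ k ≤ s ∧ s ^ 2 ≤ m ∧
      (e : ℤ) = (m + c + h) * (m - h) + 1 ∧ e ≤ n ^ 2 / 4 ∧ e ≤ (s + 1) ^ 4 ∧
      16 ≤ e ∧ 2 ≤ p₀ ∧ 0 < q₀ ∧ p₀ + q₀ ≤ n ∧ e = p₀ * q₀ + 1 := by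
  obtain ⟨m, c, hc, hnm⟩ : ∃ m c : ℕ, c ≤ 1 ∧ n = 2 * m + c := ⟨n / 2, n % 2, by omega, by omega⟩
  have hkm : (k + 10) ^ 2 ≤ m := by omega
  obtain ⟨s, hks, hsm, hms⟩ : ∃ s, k + 10 ≤ s ∧ s ^ 2 ≤ m ∧ m < (s + 1) ^ 2 :=
    ⟨Nat.sqrt m, Nat.le_sqrt'.2 hkm, Nat.sqrt_le' m, Nat.lt_succ_sqrt' m⟩
  obtain ⟨h, rfl⟩ : ∃ h, s = h + 2 := ⟨s - 2, by omega⟩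
  have hh8 : 8 ≤ h := by omega
  have hhm : h + 10 ≤ m := by
    calc h + 10 ≤ (h + 2) ^ 2 := by nlinarith only [hh8]
      _ ≤ m := hsm
  obtain ⟨q, rfl⟩ : ∃ q, m = h + q := ⟨m - h, by omega⟩
  have hez : (((h + q + c + h) * q + 1 : ℕ) : ℤ)
      = (((h + q : ℕ) : ℤ) + c + h) * (((h + q : ℕ) : ℤ) - h) + 1 := by
    push_cast
    ring
  refine ⟨h + q, c, h, h + 2, h + q + c + h, q, (h + q + c + h) * q + 1, hc, hnm, rfl, hh8,
    by omega, hsm, hez, ?_, ?_, ?_, by omega, by omega, by omega, rfl⟩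
  · rw [Nat.le_div_iff_mul_le (by norm_num), hnm]
    have h1 : (2 * (h + q) + c) ^ 2 = (h + q + c + h) * q * 4 + (2 * h + c) ^ 2 := by ring
    have h2 : 4 ≤ (2 * h + c) ^ 2 := by
      calc 4 = 2 ^ 2 := rfl
        _ ≤ (2 * h + c) ^ 2 := Nat.pow_le_pow_left (by omega) 2
    omega
  · have h1 : c * q ≤ 1 * q := Nat.mul_le_mul_right q hc
    calc (h + q + c + h) * q + 1 = q * q + 2 * h * q + c * q + 1 := by ring
      _ ≤ (h + q + 1) ^ 2 := by nlinarith only [h1]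
      _ ≤ ((h + 2 + 1) ^ 2) ^ 2 := Nat.pow_le_pow_left hms 2
      _ = _ := by ring
  · have := Nat.mul_le_mul (show 10 ≤ h + q + c + h by omega) (show 10 ≤ q by omega)
    omega

/-- For every large `n` some edge count forces the bipartite maximum below the maximum by a factor
`1 - (1 - ε) e ^ (-3 / 4)`. -/
theorem exists_card_edges_gap {ε : ℝ} (hε0 : 0 < ε) (hε1 : ε ≤ 1) :
    ∃ N : ℕ, ∀ n : ℕ, N ≤ n → ∃ e : ℕ, 1 ≤ e ∧ e ≤ n ^ 2 / 4 ∧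
      maxBipartiteSpread n e ≤ (1 - (1 - ε) / (e : ℝ) ^ (3 / 4 : ℝ)) * maxSpread n e := by
  obtain ⟨k, hk⟩ := exists_nat_ge (53 / (4 * ε))
  have hk' : 53 ≤ 4 * ε * k := by
    rw [div_le_iff₀ (by positivity)] at hk
    linarith
  refine ⟨2 * (k + 10) ^ 2, fun n hn => ?_⟩
  obtain ⟨m, c, h, s, p₀, q₀, e, hc, hnm, hh, hh8, hks, hsm, hez, hen, heu, he16, hp₀, hq₀, hpq,
    he⟩ := exists_gap_parameters k hn
  have he16' : (16 : ℝ) ≤ e := by exact_mod_cast he16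
  have heu' : (e : ℝ) ≤ ((s : ℝ) + 1) ^ 4 := by exact_mod_cast heu
  set w : ℝ := (e : ℝ) ^ (1 / 4 : ℝ) with hw
  have hw0 : 0 ≤ w := by positivity
  have hw4 : w ^ 4 = e := by
    rw [hw, ← Real.rpow_natCast, ← Real.rpow_mul (by positivity)]
    norm_num
  have hw3 : (e : ℝ) ^ (3 / 4 : ℝ) = w ^ 3 := by
    rw [hw, ← Real.rpow_natCast, ← Real.rpow_mul (by positivity)]
    norm_num
  have hw2 : 2 ≤ w := le_of_pow_le_pow_left₀ four_ne_zero hw0 (by rw [hw4]; linarith)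
  have hwu : w ≤ (s : ℝ) + 1 :=
    le_of_pow_le_pow_left₀ four_ne_zero (by positivity) (by rw [hw4]; exact heu')
  have hS : 2 * √(w ^ 4 - 1) ≤ maxSpread n e := by
    have h1 := two_mul_sqrt_le_maxSpread hp₀ hq₀ hpq
    have h2 : w ^ 4 - 1 = (p₀ : ℝ) * q₀ := by
      rw [hw4, he]
      push_cast
      ring
    rwa [h2, he]
  refine ⟨e, by omega, hen, ?_⟩
  rw [hw3]
  refine Real.sSup_le ?_ ?_
  · rintro _ ⟨G, hG, hGe, rfl⟩
    refine le_one_sub_mul_of_pow_four_le hw2 hwu hε0 hε1 ?_ le_rfl ?_ hS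
    · have : (k : ℝ) ≤ s + 1 := by
        have : k ≤ s + 1 := hks.trans (Nat.le_succ s)
        exact_mod_cast this
      exact hk'.trans (mul_le_mul_of_nonneg_left this (by positivity))
    · rw [hw4]
      exact hG.graphSpread_pow_four_le_of_card_eq hc hnm hh (by omega) hsm hez hGe
  · refine mul_nonneg ?_ (maxSpread_nonneg n e)
    rw [sub_nonneg, div_le_one (by positivity)]
    have : (1 : ℝ) ≤ w ^ 3 := one_le_pow₀ (by linarith)
    linarith

theorem theorem1p2 :
    -- the upper bound, for all `n` and `e`
    (∀ n e : ℕ, 1 ≤ e → e ≤ n ^ 2 / 4 →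
      maxSpread n e - maxBipartiteSpread n e ≤
        (1 + 16 * (e : ℝ) ^ (-(3 / 4) : ℝ)) / (e : ℝ) ^ (3 / 4 : ℝ) * maxSpread n e) ∧
    -- the conjecture holds asymptotically as `e → ∞`, uniformly in `n`
    (∀ ε : ℝ, 0 < ε → ∃ e₀ : ℕ, ∀ n e : ℕ, e₀ ≤ e → e ≤ n ^ 2 / 4 →
      (1 - ε) * maxSpread n e ≤ maxBipartiteSpread n e) ∧
    -- the upper bound is tight up to lower order terms
    (∀ ε : ℝ, 0 < ε → ∃ N : ℕ, ∀ n : ℕ, N ≤ n → ∃ e : ℕ, 1 ≤ e ∧ e ≤ n ^ 2 / 4 ∧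
      (1 - ε) / (e : ℝ) ^ (3 / 4 : ℝ) * maxSpread n e ≤
        maxSpread n e - maxBipartiteSpread n e) ∧
    -- the exact conjecture fails for infinitely many `n`
    {n : ℕ | ∃ e : ℕ, e ≤ n ^ 2 / 4 ∧ maxBipartiteSpread n e < maxSpread n e}.Infinite := by
  have hupper : ∀ n e : ℕ, 1 ≤ e → e ≤ n ^ 2 / 4 →
      maxSpread n e - maxBipartiteSpread n e ≤ 1 / (e : ℝ) ^ (3 / 4 : ℝ) * maxSpread n e := by
    intro n e he hen
    have he0 : (0 : ℝ) < e := by exact_mod_cast he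
    have h := one_sub_mul_maxSpread_le he hen (w := (e : ℝ) ^ (1 / 4 : ℝ)) (by positivity)
      (by rw [← Real.rpow_natCast, ← Real.rpow_mul he0.le]; norm_num)
    rw [← Real.rpow_natCast, ← Real.rpow_mul he0.le] at h
    norm_num at h ⊢
    linarith
  have hlower : ∀ ε : ℝ, 0 < ε → ∃ N : ℕ, ∀ n : ℕ, N ≤ n → ∃ e : ℕ, 1 ≤ e ∧ e ≤ n ^ 2 / 4 ∧
      (1 - ε) / (e : ℝ) ^ (3 / 4 : ℝ) * maxSpread n e ≤
        maxSpread n e - maxBipartiteSpread n e := by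
    intro ε hε
    obtain ⟨N, hN⟩ := exists_card_edges_gap (lt_min hε one_pos) (min_le_right ε 1)
    refine ⟨N, fun n hn => ?_⟩
    obtain ⟨e, he, hen, h⟩ := hN n hn
    refine ⟨e, he, hen, ?_⟩
    have hle : (1 - ε) / (e : ℝ) ^ (3 / 4 : ℝ) * maxSpread n e ≤
        (1 - min ε 1) / (e : ℝ) ^ (3 / 4 : ℝ) * maxSpread n e :=
      mul_le_mul_of_nonneg_right
        (div_le_div_of_nonneg_right (by linarith [min_le_left ε 1]) (by positivity))
        (maxSpread_nonneg n e)
    linarith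
  refine ⟨fun n e he hen => (hupper n e he hen).trans ?_, fun ε hε => ?_, hlower, ?_⟩
  · refine mul_le_mul_of_nonneg_right ?_ (maxSpread_nonneg n e)
    refine div_le_div_of_nonneg_right ?_ (by positivity)
    have : (0 : ℝ) ≤ (e : ℝ) ^ (-(3 / 4) : ℝ) := by positivity
    linarith
  · have hlim : Filter.Tendsto (fun e : ℕ => 1 / (e : ℝ) ^ (3 / 4 : ℝ)) Filter.atTop (nhds 0) := by
      simp only [one_div]
      exact ((tendsto_rpow_atTop (by norm_num)).comp tendsto_natCast_atTop_atTop).inv_tendsto_atTop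
    obtain ⟨e₀, he₀⟩ := Filter.eventually_atTop.1 (hlim.eventually_le_const hε)
    refine ⟨max e₀ 1, fun n e he hen => ?_⟩
    have h1 := hupper n e ((le_max_right _ _).trans he) hen
    have h2 := mul_le_mul_of_nonneg_right (he₀ e ((le_max_left _ _).trans he))
      (maxSpread_nonneg n e)
    linarith
  · obtain ⟨N, hN⟩ := hlower (1 / 2) (by norm_num)
    refine (Set.Ici_infinite N).mono fun n hn => ?_
    obtain ⟨e, he, hen, h⟩ := hN n hn
    refine ⟨e, hen, ?_⟩
    have he0 : (0 : ℝ) < e := by exact_mod_cast he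
    have : 0 < (1 - 1 / 2) / (e : ℝ) ^ (3 / 4 : ℝ) * maxSpread n e :=
      mul_pos (div_pos (by norm_num) (by positivity)) (maxSpread_pos he hen)
    linarith
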